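/- \textbf{Theorem (Outcome code of a Clifford circuit).} Let $\mathcal C=(C_1,\dots,C_s)$ be a Clifford circuit on $n$ qubits, i.e. a finite sequence of operations, each of which is either a Clifford unitary (a unitary $U$ such that $UPU^{-1}$ is an $n$-qubit Pauli operator for every $n$-qubit Pauli operator $P$; Pauli operators are tensor products of $I,X,Y,Z$ up to a phase in $\{\pm1,\pm i\}$) or the measurement of a Hermitian Pauli operator. Let $m$ be the number of measurements and $S_1,\dots,S_m$ the measured operators, in chronological order; outcome $o_j\in\mathbb Z_2$ of the measurement of $S_j$ corresponds to the eigenvalue $(-1)^{o_j}$, i.e. to the projector $\frac12(I+(-1)^{o_j}S_j)$. Let $\mathcal O(\mathcal C)\subseteq\mathbb Z_2^m$ be the set of all possible outcome bit-strings, i.e. of those $o=(o_1,\dots,o_m)$ that are observed with non-zero probability for at least one input state (density matrix) of the $n$ qubits. Then $\mathcal O(\mathcal C)$ is a (non-empty) affine subspace of $\mathbb Z_2^m$. Moreover, consider the following algorithm (a modified stabilizer simulation). It maintains a finite collection $\mathcal S$ of Pauli operators $T$, each augmented with a set $K(T)\subseteq\{1,\dots,m\}$ of measurement indices, and a finite collection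 $R$ of affine checks; both are empty at the start. For $i=1,\dots,s$: \begin{itemize} \item If $C_i$ is a unitary, replace every $T\in\mathcal S$ by $C_iTC_i^{-1}$ (keeping $K(T)$). \item If $C_i$ is the measurement of $S_j$ and $(-1)^bS_j\in\langle\mathcal S\rangle$ for some $b\in\mathbb Z_2$, write $(-1)^bS_j$ as a product of distinct elements of $\mathcal S$, let $K_j$ be the symmetric difference of the index sets of these elements, and add the check $o_j+\sum_{k\in K_j}o_k=b$ to $R$. \item If $C_i$ is the measurement of $S_j$ and $\pm S_j\notin\langle\mathcal S\rangle$: if some $T\in\mathcal S$ anti-commutes with $S_j$, choose such a $T$, replace every other $T'\in\mathcal S$ that anti-commutes with $S_j$ by $TT'$, with index set the symmetric difference of $K(T)$ and $K(T')$, and remove $T$ from $\mathcal S$. In all cases then add $S_j$, with index set $\{j\}$, to $\mathcal S$. \end{itemize} The output is $R$. Then, whatever choices are made (of the anti-commuting element $T$ and of the decomposition of $(-1)^bS_j$), each step can be carried out, so that the algorithm runs to completion, and its output is a complete set of affine checks for $\mathcal O(\mathcal C)$: $$\mathcal O(\mathcal C)=\{o\in\mathbb Z_2^m : o\text{ satisfies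 every check in }R\}.$$ -/

import Mathlib

open scoped Matrix ComplexOrder

namespace CliffordSim

noncomputable section

/-! ### Pauli operators, Clifford gates, Clifford circuits -/

/-- Linear operators on the `n`-qubit space `(ℂ²)^{⊗ n}`, as matrices in the computational basis,
which is indexed by bit-strings `Fin n → Fin 2`. -/
abbrev QOp (n : ℕ) : Type := Matrix (Fin n → Fin 2) (Fin n → Fin 2) ℂ

/-- The unitary group of the `n`-qubit space. -/
abbrev QUnitary (n : ℕ) : Type := Matrix.unitaryGroup (Fin n → Fin 2) ℂ

/-- Names of the four single-qubit Pauli matrices. -/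
inductive PauliName : Type
  | I | X | Y | Z

/-- The single-qubit Pauli matrices. -/
def PauliName.mat : PauliName → Matrix (Fin 2) (Fin 2) ℂ
  | .I => !![1, 0; 0, 1]
  | .X => !![0, 1; 1, 0]
  | .Y => !![0, -Complex.I; Complex.I, 0]
  | .Z => !![1, 0; 0, -1]

/-- The tensor product `P 0 ⊗ P 1 ⊗ ⋯ ⊗ P (n - 1)` of single-qubit Pauli matrices. -/
def pauliString {n : ℕ} (P : Fin n → PauliName) : QOp n :=
  Matrix.of fun x y => ∏ q, (P q).mat (x q) (y q)

/-- `A` is an `n`-qubit Pauli operator: a tensor product of single-qubit Pauli matrices, up to a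
phase in `{1, i, -1, -i}`. -/
def IsPauli {n : ℕ} (A : QUnitary n) : Prop :=
  ∃ (k : Fin 4) (P : Fin n → PauliName), (A : QOp n) = Complex.I ^ (k : ℕ) • pauliString P

/-- A Clifford unitary gate: a unitary (with arbitrary support) that conjugates Pauli operators to
Pauli operators. -/
structure CliffordGate (n : ℕ) : Type where
  op : QUnitary n
  conj_isPauli : ∀ P : QUnitary n, IsPauli P → IsPauli (op * P * op⁻¹)

/-- A Pauli operator that can be measured: a Hermitian one, that is `±` a Pauli string. -/
structure PauliObservable (n : ℕ) : Type where
  op : QUnitary n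
  isPauli : IsPauli op
  isHermitian : (op : QOp n).IsHermitian

/-- `CliffordCircuit n m` is the type of Clifford circuits on `n` qubits with `m` Pauli
measurements: finite sequences, in chronological order, of Clifford gates and Pauli measurements,
of which exactly `m` are measurements. The measurements are numbered `0, …, m - 1` in
chronological order. The constructors `gate` and `measure` append one operation at the end.
(Time steps are not recorded: every sequence can be given the time steps `1, 2, …`, and operations
carried out at the same time step have disjoint supports, so that executing them one after the
other is the same.) -/
inductive CliffordCircuit (n : ℕ) : ℕ → Type
  | nil : CliffordCircuit n 0
  | gate {m : ℕ} (C : CliffordCircuit n m) (U : CliffordGate n) : CliffordCircuit n m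
  | measure {m : ℕ} (C : CliffordCircuit n m) (S : PauliObservable n) : CliffordCircuit n (m + 1)

/-! ### Execution of a circuit and its outcome code -/

/-- The projector `(1 + (-1)^b S) / 2` associated with outcome `b` of the measurement of `S`. -/
def PauliObservable.projector {n : ℕ} (S : PauliObservable n) (b : ZMod 2) : QOp n :=
  (1 / 2 : ℂ) • (1 + (-1 : ℂ) ^ b.val • (S.op : QOp n))

/-- The unnormalized state obtained by running the circuit on the input state `ρ` and observing
the outcomes `o`: a gate maps `ρ` to `U ρ U†`, the measurement of `S` with outcome `b` maps `ρ`
to `Π ρ Π`, with `Π = (1 + (-1)^b S) / 2`. Its trace is the probability of `o`. -/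
def CliffordCircuit.branch {n : ℕ} :
    {m : ℕ} → CliffordCircuit n m → (Fin m → ZMod 2) → QOp n → QOp n
  | _, .nil, _, ρ => ρ
  | _, .gate C U, o, ρ => (U.op : QOp n) * C.branch o ρ * (U.op : QOp n)ᴴ
  | _, .measure (m := m) C S, o, ρ =>
      S.projector (o (Fin.last m)) * C.branch (fun k => o k.castSucc) ρ *
        S.projector (o (Fin.last m))

/-- The probability of the outcome bit-string `o` when the input state is `ρ`. -/
def CliffordCircuit.prob {n m : ℕ} (C : CliffordCircuit n m) (ρ : QOp n) (o : Fin m → ZMod 2) : ℝ :=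
  (C.branch o ρ).trace.re

/-- Density matrices, that is (possibly mixed) quantum states of `n` qubits. -/
def IsDensityMatrix {n : ℕ} (ρ : QOp n) : Prop :=
  ρ.PosSemidef ∧ ρ.trace = 1

/-- The set `O(C)` of all possible outcome bit-strings: those which occur with non-zero probability
for some input state. -/
def CliffordCircuit.outcomeCode {n m : ℕ} (C : CliffordCircuit n m) : Set (Fin m → ZMod 2) :=
  {o | ∃ ρ : QOp n, IsDensityMatrix ρ ∧ 0 < C.prob ρ o}

/-! ### The modified stabilizer simulation -/

/-- The affine check `∑ k, coeff k * o k = rhs` on bit-strings `o`; the set of indices that enter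
the check is `{k | coeff k = 1}`. -/
structure AffineCheck (m : ℕ) : Type where
  coeff : Fin m → ZMod 2
  rhs : ZMod 2

/-- The bit-string `o` satisfies the check `c`. -/
def AffineCheck.Holds {m : ℕ} (c : AffineCheck m) (o : Fin m → ZMod 2) : Prop :=
  ∑ k, c.coeff k * o k = c.rhs

/-- A check on `m` outcomes, seen as a check on `m + 1` outcomes. -/
def AffineCheck.extend {m : ℕ} (c : AffineCheck m) : AffineCheck (m + 1) where
  coeff := Fin.snoc (α := fun _ => ZMod 2) c.coeff 0
  rhs := c.rhs

/-- A stabilizer generator kept by the algorithm: an operator, augmented with the set of the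
(indices of) measurements it comes from, given by its indicator vector. -/
structure Generator (n m : ℕ) : Type where
  op : QUnitary n
  label : Fin m → ZMod 2

/-- A generator with its label seen as a set of indices among `m + 1` measurements. -/
def Generator.extend {n m : ℕ} (T : Generator n m) : Generator n (m + 1) where
  op := T.op
  label := Fin.snoc (α := fun _ => ZMod 2) T.label 0

/-- Replacement of `T` by `U T U⁻¹`. -/
def Generator.conj {n m : ℕ} (U : CliffordGate n) (T : Generator n m) : Generator n m where
  op := U.op * T.op * U.op⁻¹
  label := T.label

/-- The generator created by the measurement, as the last of `m + 1` measurements, of `S`. -/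
def Generator.ofMeasurement {n : ℕ} (m : ℕ) (S : PauliObservable n) : Generator n (m + 1) where
  op := S.op
  label := Pi.single (Fin.last m) 1

/-- `T` anti-commutes with `S`. -/
def Generator.AntiCommutes {n m : ℕ} (T : Generator n m) (S : PauliObservable n) : Prop :=
  T.op * S.op = -(S.op * T.op)

open Classical in
/-- Replacement of `T'` by `T T'` if `T'` anti-commutes with `S`; otherwise `T'` is kept.
The labels are combined by symmetric difference. -/
def Generator.update {n m : ℕ} (S : PauliObservable n) (T T' : Generator n m) : Generator n m :=
  if T'.AntiCommutes S then ⟨T.op * T'.op, T.label + T'.label⟩ else T'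

/-- The two collections maintained by the algorithm: the stabilizer generators `𝒮` and the checks
`R` found so far. The order of the lists is immaterial. -/
structure SimState (n m : ℕ) : Type where
  gens : List (Generator n m)
  checks : List (AffineCheck m)

/-- The group `⟨𝒮⟩` generated by the stabilizer generators. -/
def SimState.stabilizerGroup {n m : ℕ} (A : SimState n m) : Subgroup (QUnitary n) :=
  Subgroup.closure {P | ∃ T ∈ A.gens, T.op = P}

/-- The operator `(-1)^b S`. -/
def PauliObservable.signed {n : ℕ} (S : PauliObservable n) (b : ZMod 2) : QUnitary n :=
  if b = 0 then S.op else -S.op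

/-- What the algorithm does when it meets the measurement of `S`. It is a relation because the
choice of the decomposition in the first case, and of the anti-commuting generator in the second
case, are left open.
* `redundant`: if `(-1)^b S ∈ ⟨𝒮⟩`, write `(-1)^b S` as a product of a subfamily `𝒟` of the
  generators, let `K` be the sum (symmetric difference) of their labels, and add the check
  `o_j + ∑_{k ∈ K} o_k = b` to `R`, where `j` is the current measurement.
* `antiCommuting`: if `±S ∉ ⟨𝒮⟩` and `T ∈ 𝒮` anti-commutes with `S`, replace every other generator
  `T'` that anti-commutes with `S` by `T T'`, remove `T` and add `S`.
* `commuting`: if `±S ∉ ⟨𝒮⟩` and no generator anti-commutes with `S`, add `S`. -/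
inductive MeasureStep {n m : ℕ} (S : PauliObservable n) : SimState n m → SimState n (m + 1) → Prop
  | redundant (A : SimState n m) (b : ZMod 2) (hmem : S.signed b ∈ A.stabilizerGroup)
      (𝒟 : List (Generator n m)) (hsub : 𝒟.Sublist A.gens)
      (hprod : S.signed b = (𝒟.map Generator.op).prod) :
      MeasureStep S A
        { gens := A.gens.map Generator.extend
          checks := A.checks.map AffineCheck.extend ++
            [{ coeff := Fin.snoc (α := fun _ => ZMod 2) (𝒟.map Generator.label).sum 1
               rhs := b }] }
  | antiCommuting (A : SimState n m) (hmem : ∀ b, S.signed b ∉ A.stabilizerGroup)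
      (𝒮₁ 𝒮₂ : List (Generator n m)) (T : Generator n m) (hT : A.gens = 𝒮₁ ++ T :: 𝒮₂)
      (hanti : T.AntiCommutes S) :
      MeasureStep S A
        { gens := ((𝒮₁ ++ 𝒮₂).map (Generator.update S T)).map Generator.extend ++
            [Generator.ofMeasurement m S]
          checks := A.checks.map AffineCheck.extend }
  | commuting (A : SimState n m) (hmem : ∀ b, S.signed b ∉ A.stabilizerGroup)
      (hcomm : ∀ T ∈ A.gens, ¬ T.AntiCommutes S) :
      MeasureStep S A
        { gens := A.gens.map Generator.extend ++ [Generator.ofMeasurement m S]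
          checks := A.checks.map AffineCheck.extend }

/-- `Simulates C A`: the algorithm, run on the circuit `C`, can end in the state `A`; its output is
then `A.checks`. The algorithm starts with `𝒮 = ∅` and `R = ∅` and goes through the operations of
the circuit one by one. -/
inductive Simulates {n : ℕ} : {m : ℕ} → CliffordCircuit n m → SimState n m → Prop
  | start : Simulates .nil { gens := [], checks := [] }
  | gate {m : ℕ} (C : CliffordCircuit n m) (U : CliffordGate n) (A : SimState n m) :
      Simulates C A →
      Simulates (C.gate U) { gens := A.gens.map (Generator.conj U), checks := A.checks }
  | measure {m : ℕ} (C : CliffordCircuit n m) (S : PauliObservable n) (A : SimState n m)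
      (A' : SimState n (m + 1)) :
      Simulates C A → MeasureStep S A A' → Simulates (C.measure S) A'

end

end CliffordSim

open CliffordSim

/-!
The circuit with observed outcomes `o` acts as `ρ ↦ K ρ K†` for a single operator `K`, so `o` is
possible for some input state exactly when `K K† ≠ 0`, that is when the circuit does not annihilate
the identity (`CliffordCircuit.mem_outcomeCode_iff`). The image of the identity is followed through
the circuit by a loop invariant (`SimState.Tracks`): it is zero unless `o` satisfies the checks found
so far, and otherwise it is a nonzero multiple of the product of the operators
`1 + (-1)^{∑_{k ∈ K(T)} o_k} T` over the generators `T`.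

This product never vanishes. The generators are commuting Pauli involutions that are independent,
which is encoded by the trace of every nontrivial product being zero (`IsStabilizerFamily`); hence
the product has the same trace as the identity (`trace_stabilizedOp`).

The invariant is preserved by a measurement of `S` for three different reasons. If `±S` is a product
of generators, then `S` acts on the product above as a sign determined by `o`, so one of the two
projectors of `S` fixes it and the other kills it; this is the new check (`measure_redundant`). If
`S` is independent of the generators and commutes with them, the projector of `S` is simply one more
factor (`measure_commuting`). If `T` anti-commutes with `S`, the other generators can be replaced by
products with `T` that commute with `S`, without changing the product (`stabilizedOp_update`); then
conjugation by a projector of `S` removes the factor of `T` (`measure_antiCommuting`).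

Consequently the outcome code is the solution set of the checks. It is not empty because the two
projectors of a measurement add up to the identity. The algorithm cannot get stuck because every
element of a group generated by commuting involutions is a product of distinct generators
(`exists_prod_of_mem_closure`).
-/

namespace CliffordSim

/-! ### Signs -/

/-- The eigenvalue `(-1)^b` that goes with the outcome bit `b`. -/
noncomputable def outcomeSign (b : ZMod 2) : ℂ := (-1) ^ b.val

@[simp] theorem outcomeSign_zero : outcomeSign 0 = 1 := by simp [outcomeSign]

@[simp] theorem outcomeSign_one : outcomeSign 1 = -1 := by
  simp [outcomeSign, ZMod.val_one]

theorem zmod_two_cases (b : ZMod 2) : b = 0 ∨ b = 1 := by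
  revert b; decide

theorem outcomeSign_add (a b : ZMod 2) :
    outcomeSign (a + b) = outcomeSign a * outcomeSign b := by
  rcases zmod_two_cases a with rfl | rfl <;> rcases zmod_two_cases b with rfl | rfl <;>
    simp [show (1 + 1 : ZMod 2) = 0 from rfl]

theorem outcomeSign_mul_self (a : ZMod 2) : outcomeSign a * outcomeSign a = 1 := by
  rcases zmod_two_cases a with rfl | rfl <;> simp

/-! ### Products, commutation and traces of Pauli operators -/

variable {n m : ℕ}

theorem PauliName.exists_mat_mul (P Q : PauliName) :
    ∃ (k : ℕ) (R : PauliName), P.mat * Q.mat = Complex.I ^ k • R.mat := by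
  cases P <;> cases Q
  all_goals first
    | refine ⟨0, .I, ?_⟩; ext i j; fin_cases i <;> fin_cases j <;> simp [PauliName.mat]; done
    | refine ⟨0, .X, ?_⟩; ext i j; fin_cases i <;> fin_cases j <;> simp [PauliName.mat]; done
    | refine ⟨0, .Y, ?_⟩; ext i j; fin_cases i <;> fin_cases j <;> simp [PauliName.mat]; done
    | refine ⟨0, .Z, ?_⟩; ext i j; fin_cases i <;> fin_cases j <;> simp [PauliName.mat]; done
    | refine ⟨1, .X, ?_⟩; ext i j; fin_cases i <;> fin_cases j <;> simp [PauliName.mat]; done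
    | refine ⟨1, .Y, ?_⟩; ext i j; fin_cases i <;> fin_cases j <;> simp [PauliName.mat]; done
    | refine ⟨1, .Z, ?_⟩; ext i j; fin_cases i <;> fin_cases j <;> simp [PauliName.mat]; done
    | refine ⟨3, .X, ?_⟩; ext i j; fin_cases i <;> fin_cases j <;> simp [PauliName.mat]; done
    | refine ⟨3, .Y, ?_⟩; ext i j; fin_cases i <;> fin_cases j <;> simp [PauliName.mat]; done
    | refine ⟨3, .Z, ?_⟩; ext i j; fin_cases i <;> fin_cases j <;> simp [PauliName.mat]

theorem PauliName.exists_mat_mul_comm (P Q : PauliName) :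
    ∃ b : ZMod 2, P.mat * Q.mat = outcomeSign b • (Q.mat * P.mat) := by
  cases P <;> cases Q
  all_goals first
    | refine ⟨0, ?_⟩; ext i j; fin_cases i <;> fin_cases j <;> simp [PauliName.mat]; done
    | refine ⟨1, ?_⟩; ext i j; fin_cases i <;> fin_cases j <;> simp [PauliName.mat]

theorem PauliName.trace_mat (P : PauliName) : P = .I ∨ P.mat.trace = 0 := by
  cases P <;> simp [PauliName.mat, Matrix.trace]

theorem PauliName.mat_I : PauliName.I.mat = 1 := by
  ext i j; fin_cases i <;> fin_cases j <;> simp [PauliName.mat]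

theorem pauliString_mul_apply (P Q : Fin n → PauliName) (x z : Fin n → Fin 2) :
    (pauliString P * pauliString Q) x z = ∏ q, ((P q).mat * (Q q).mat) (x q) (z q) := by
  simp only [Matrix.mul_apply, pauliString, Matrix.of_apply, ← Finset.prod_mul_distrib]
  rw [Finset.prod_univ_sum, Fintype.piFinset_univ]

theorem exists_pauliString_mul (P Q : Fin n → PauliName) :
    ∃ (k : ℕ) (R : Fin n → PauliName),
      pauliString P * pauliString Q = Complex.I ^ k • pauliString R := by
  choose k R h using fun q => PauliName.exists_mat_mul (P q) (Q q)
  refine ⟨∑ q, k q, R, ?_⟩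
  ext x z
  rw [pauliString_mul_apply]
  simp only [h, Matrix.smul_apply, smul_eq_mul, Finset.prod_mul_distrib,
    Finset.prod_pow_eq_pow_sum, pauliString, Matrix.of_apply]

theorem outcomeSign_sum {ι : Type*} (s : Finset ι) (f : ι → ZMod 2) :
    outcomeSign (∑ i ∈ s, f i) = ∏ i ∈ s, outcomeSign (f i) := by
  classical
  induction s using Finset.induction_on with
  | empty => simp
  | insert a s ha ih => rw [Finset.sum_insert ha, Finset.prod_insert ha, outcomeSign_add, ih]

/-- Two Pauli strings commute up to the product of the signs of their tensor factors. -/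
theorem exists_pauliString_mul_comm (P Q : Fin n → PauliName) :
    ∃ b : ZMod 2,
      pauliString P * pauliString Q = outcomeSign b • (pauliString Q * pauliString P) := by
  choose b h using fun q => PauliName.exists_mat_mul_comm (P q) (Q q)
  refine ⟨∑ q, b q, ?_⟩
  ext x z
  simp only [pauliString_mul_apply, h, Matrix.smul_apply, smul_eq_mul, Finset.prod_mul_distrib,
    outcomeSign_sum]

theorem pauliString_eq_one_or_trace_eq_zero (P : Fin n → PauliName) :
    pauliString P = 1 ∨ (pauliString P).trace = 0 := by
  by_cases h : ∀ q, P q = .I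
  · left
    ext x y
    simp only [pauliString, h, PauliName.mat_I, Matrix.of_apply, Matrix.one_apply, funext_iff]
    rw [Finset.prod_boole]
    simp
  · right
    push Not at h
    obtain ⟨q, hq⟩ := h
    have : (pauliString P).trace = ∏ q, (P q).mat.trace := by
      simp only [Matrix.trace, Matrix.diag_apply, pauliString, Matrix.of_apply]
      rw [Finset.prod_univ_sum, Fintype.piFinset_univ]
    rw [this]
    exact Finset.prod_eq_zero (Finset.mem_univ q) ((P q).trace_mat.resolve_left hq)

theorem isPauli_of_eq_I_pow_smul {A : QUnitary n} {k : ℕ} {P : Fin n → PauliName}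
    (h : (A : QOp n) = Complex.I ^ k • pauliString P) : IsPauli A := by
  refine ⟨⟨k % 4, Nat.mod_lt _ (by norm_num)⟩, P, ?_⟩
  rw [h, Complex.I_pow_eq_pow_mod]

theorem isPauli_one : IsPauli (1 : QUnitary n) :=
  ⟨0, fun _ => .I, by
    ext x y
    simp [pauliString, PauliName.mat_I, Matrix.one_apply, Finset.prod_boole, funext_iff]⟩

theorem IsPauli.mul {A B : QUnitary n} (hA : IsPauli A) (hB : IsPauli B) : IsPauli (A * B) := by
  obtain ⟨k, P, hP⟩ := hA
  obtain ⟨l, Q, hQ⟩ := hB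
  obtain ⟨r, R, hR⟩ := exists_pauliString_mul P Q
  refine isPauli_of_eq_I_pow_smul (k := k + l + r) (P := R) ?_
  rw [Submonoid.coe_mul, hP, hQ, Matrix.smul_mul, Matrix.mul_smul, hR, smul_smul, smul_smul,
    ← pow_add, ← pow_add, add_assoc]

theorem isPauli_list_prod {L : List (QUnitary n)} (h : ∀ A ∈ L, IsPauli A) : IsPauli L.prod := by
  induction L with
  | nil => exact isPauli_one
  | cons A L ih =>
    rw [List.prod_cons]
    exact (h A (by simp)).mul (ih fun B hB => h B (by simp [hB]))

theorem coe_neg_unitary (A : QUnitary n) : ((-A : QUnitary n) : QOp n) = -(A : QOp n) := rfl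

theorem IsPauli.commute_or_anticommute {A B : QUnitary n} (hA : IsPauli A) (hB : IsPauli B) :
    Commute A B ∨ A * B = -(B * A) := by
  obtain ⟨k, P, hP⟩ := hA
  obtain ⟨l, Q, hQ⟩ := hB
  obtain ⟨b, h⟩ := exists_pauliString_mul_comm P Q
  have key : (A : QOp n) * B = outcomeSign b • ((B : QOp n) * A) := by
    simp only [hP, hQ, Matrix.smul_mul, Matrix.mul_smul, h, smul_smul]
    congr 1; ring
  rcases zmod_two_cases b with rfl | rfl
  · left; exact Subtype.ext (by simpa using key)
  · right; exact Subtype.ext (by simpa [coe_neg_unitary] using key)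

theorem IsPauli.eq_smul_one_or_trace_eq_zero {A : QUnitary n} (hA : IsPauli A) :
    (∃ z : ℂ, (A : QOp n) = z • 1) ∨ (A : QOp n).trace = 0 := by
  obtain ⟨k, P, hP⟩ := hA
  rcases pauliString_eq_one_or_trace_eq_zero P with h | h
  · left; exact ⟨_, by rw [hP, h]⟩
  · right; rw [hP, Matrix.trace_smul, h, smul_zero]

theorem PauliObservable.op_mul_self (S : PauliObservable n) : S.op * S.op = 1 := by
  apply Subtype.ext
  have h := Matrix.mem_unitaryGroup_iff.mp S.op.2
  rw [Matrix.star_eq_conjTranspose, S.isHermitian.eq] at h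
  exact h

theorem PauliObservable.coe_signed (S : PauliObservable n) (b : ZMod 2) :
    (S.signed b : QOp n) = outcomeSign b • (S.op : QOp n) := by
  rcases zmod_two_cases b with rfl | rfl <;> simp [PauliObservable.signed, coe_neg_unitary]

/-! ### Independent families of commuting Pauli involutions -/

/-- A list of commuting Pauli operators with square `1` that is independent modulo phases.
Independence is expressed by traces: a Pauli operator has trace zero unless it is a scalar. -/
structure IsStabilizerFamily (L : List (QUnitary n)) : Prop where
  isPauli : ∀ A ∈ L, IsPauli A
  mul_self : ∀ A ∈ L, A * A = 1
  commute : ∀ A ∈ L, ∀ B ∈ L, Commute A B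
  trace_prod : ∀ D : List (QUnitary n), D.Sublist L → D ≠ [] →
    ((D.prod : QUnitary n) : QOp n).trace = 0

namespace IsStabilizerFamily

theorem nil : IsStabilizerFamily ([] : List (QUnitary n)) where
  isPauli := by simp
  mul_self := by simp
  commute := by simp
  trace_prod := by
    intro D hD h
    exact absurd (List.sublist_nil.mp hD) h

theorem perm {L L' : List (QUnitary n)} (h : IsStabilizerFamily L) (p : L.Perm L') :
    IsStabilizerFamily L' where
  isPauli A hA := h.isPauli A (p.mem_iff.mpr hA)
  mul_self A hA := h.mul_self A (p.mem_iff.mpr hA)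
  commute A hA B hB := h.commute A (p.mem_iff.mpr hA) B (p.mem_iff.mpr hB)
  trace_prod D hD hne := by
    obtain ⟨D', hD', q⟩ : ∃ D', D'.Sublist L ∧ D'.Perm D := hD.subperm.trans p.symm.subperm |>.elim
      fun D' h => ⟨D', h.2, h.1⟩
    have hc : D'.Pairwise Commute := List.pairwise_of_forall_mem_list fun A hA B hB =>
      h.commute A (hD'.subset hA) B (hD'.subset hB)
    rw [← q.prod_eq' hc]
    refine h.trace_prod D' hD' ?_
    rintro rfl
    exact hne (List.nil_perm.mp q)

theorem commute_prod {L D : List (QUnitary n)} (h : IsStabilizerFamily L) (hD : D.Sublist L)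
    {A : QUnitary n} (hA : A ∈ L) : Commute A D.prod :=
  Commute.list_prod_right _ _ fun B hB => h.commute A hA B (hD.subset hB)

theorem prod_mul_self {L D : List (QUnitary n)} (h : IsStabilizerFamily L) (hD : D.Sublist L) :
    D.prod * D.prod = 1 := by
  induction D with
  | nil => simp
  | cons A D ih =>
    have hD' : D.Sublist L := (List.sublist_cons_self A D).trans hD
    have hA : A ∈ L := hD.subset (by simp)
    rw [List.prod_cons, (h.commute_prod hD' hA).symm.mul_mul_mul_comm, h.mul_self A hA, ih hD', one_mul]

theorem conj {L : List (QUnitary n)} (h : IsStabilizerFamily L) (U : CliffordGate n) :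
    IsStabilizerFamily (L.map fun A => U.op * A * U.op⁻¹) where
  isPauli := by
    simp only [List.mem_map]
    rintro _ ⟨A, hA, rfl⟩
    exact U.conj_isPauli A (h.isPauli A hA)
  mul_self := by
    simp only [List.mem_map]
    rintro _ ⟨A, hA, rfl⟩
    rw [conj_mul, h.mul_self A hA]
    group
  commute := by
    simp only [List.mem_map]
    rintro _ ⟨A, hA, rfl⟩ _ ⟨B, hB, rfl⟩
    exact (Commute.conj_iff U.op).mpr (h.commute A hA B hB)
  trace_prod D hD hne := by
    obtain ⟨D', hD', rfl⟩ := List.sublist_map_iff.mp hD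
    have hp : (D'.map fun A => U.op * A * U.op⁻¹).prod = U.op * D'.prod * U.op⁻¹ :=
      (map_list_prod (MulAut.conj U.op) D').symm
    rw [hp, Submonoid.coe_mul, Matrix.trace_mul_comm, ← Submonoid.coe_mul, ← mul_assoc,
      inv_mul_cancel, one_mul]
    refine h.trace_prod D' hD' ?_
    rintro rfl
    exact hne rfl

/-- A list is extended by an observable that commutes with it and is trace-orthogonal to all
products of subfamilies. -/
theorem append {L : List (QUnitary n)} (h : IsStabilizerFamily L) (S : PauliObservable n)
    (hS : ∀ A ∈ L, Commute A S.op)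
    (htr : ∀ D : List (QUnitary n), D.Sublist L → (D.prod * S.op : QOp n).trace = 0) :
    IsStabilizerFamily (L ++ [S.op]) where
  isPauli A hA := by
    rcases List.mem_append.mp hA with hA | hA
    · exact h.isPauli A hA
    · rw [List.mem_singleton.mp hA]; exact S.isPauli
  mul_self A hA := by
    rcases List.mem_append.mp hA with hA | hA
    · exact h.mul_self A hA
    · rw [List.mem_singleton.mp hA]; exact S.op_mul_self
  commute A hA B hB := by
    rcases List.mem_append.mp hA with hA | hA <;> rcases List.mem_append.mp hB with hB | hB
    · exact h.commute A hA B hB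
    · rw [List.mem_singleton.mp hB]; exact hS A hA
    · rw [List.mem_singleton.mp hA]; exact (hS B hB).symm
    · rw [List.mem_singleton.mp hA, List.mem_singleton.mp hB]
  trace_prod D hD hne := by
    obtain ⟨D₁, D₂, rfl, h₁, h₂⟩ := List.sublist_append_iff.mp hD
    rcases List.sublist_singleton.mp h₂ with rfl | rfl
    · rw [List.append_nil] at hne ⊢
      exact h.trace_prod D₁ h₁ hne
    · rw [List.prod_append, List.prod_singleton, Submonoid.coe_mul]
      exact htr D₁ h₁

/-- If the product of a subfamily with `S` were a scalar, its square would force it to be `±1`, so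
that `±S` would be a product of members of the family. -/
theorem append_of_commute {L : List (QUnitary n)} (h : IsStabilizerFamily L) (S : PauliObservable n)
    (hS : ∀ A ∈ L, Commute A S.op)
    (hmem : ∀ b, ∀ D : List (QUnitary n), D.Sublist L → S.signed b ≠ D.prod) :
    IsStabilizerFamily (L ++ [S.op]) := by
  refine h.append S hS fun D hD => ?_
  have hP : IsPauli (D.prod * S.op) :=
    (isPauli_list_prod fun A hA => h.isPauli A (hD.subset hA)).mul S.isPauli
  rcases hP.eq_smul_one_or_trace_eq_zero with ⟨z, hz⟩ | h0
  · exfalso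
    have hDS : (D.prod : QOp n) = z • (S.op : QOp n) := by
      have h1 : D.prod = D.prod * S.op * S.op := by rw [mul_assoc, S.op_mul_self, mul_one]
      rw [h1, Submonoid.coe_mul, hz, Matrix.smul_mul, one_mul]
    have hz2 : z * z = 1 := by
      have h1 := congrArg (Subtype.val : QUnitary n → QOp n) (h.prod_mul_self hD)
      have h2 := congrArg (Subtype.val : QUnitary n → QOp n) S.op_mul_self
      rw [Submonoid.coe_mul, OneMemClass.coe_one] at h1 h2
      rw [hDS, Matrix.smul_mul, Matrix.mul_smul, h2, smul_smul] at h1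
      have h3 := congrFun (congrFun h1 0) 0
      simpa using h3
    rcases mul_self_eq_one_iff.mp hz2 with rfl | rfl
    · exact hmem 0 D hD (Subtype.ext (by rw [hDS, S.coe_signed, outcomeSign_zero]))
    · exact hmem 1 D hD (Subtype.ext (by rw [hDS, S.coe_signed, outcomeSign_one]))
  · exact h0

/-- A left factor from the family is cancelled if it occurs in the product and inserted if not. -/
theorem exists_mul_prod_eq {L : List (QUnitary n)} (hsq : ∀ A ∈ L, A * A = 1)
    (hc : ∀ A ∈ L, ∀ B ∈ L, Commute A B) {A : QUnitary n} (hA : A ∈ L) {D : List (QUnitary n)}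
    (hD : D.Sublist L) : ∃ D' : List (QUnitary n), D'.Sublist L ∧ A * D.prod = D'.prod := by
  induction L generalizing D with
  | nil => simp at hA
  | cons B L ih =>
    rcases List.mem_cons.mp hA with rfl | hA'
    · rcases List.sublist_cons_iff.mp hD with hD | ⟨D', rfl, hD'⟩
      · exact ⟨A :: D, hD.cons_cons A, by rw [List.prod_cons]⟩
      · exact ⟨D', hD'.cons A, by rw [List.prod_cons, ← mul_assoc, hsq A hA, one_mul]⟩
    · have ih' := fun D => ih (D := D) (fun A hA => hsq A (List.mem_cons_of_mem _ hA))
        (fun A hA B hB => hc A (List.mem_cons_of_mem _ hA) B (List.mem_cons_of_mem _ hB)) hA'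
      rcases List.sublist_cons_iff.mp hD with hD | ⟨D', rfl, hD'⟩
      · obtain ⟨E, hE, h⟩ := ih' D hD
        exact ⟨E, hE.cons B, h⟩
      · obtain ⟨E, hE, h⟩ := ih' D' hD'
        refine ⟨B :: E, hE.cons_cons B, ?_⟩
        rw [List.prod_cons, List.prod_cons, ← h, ← mul_assoc, ← mul_assoc,
          (hc A hA B (by simp)).eq]

/-- Every element of the group generated by commuting involutions is the product of a subfamily. -/
theorem exists_prod_of_mem_closure {L : List (QUnitary n)} (h : IsStabilizerFamily L)
    {x : QUnitary n} (hx : x ∈ Subgroup.closure {A | A ∈ L}) :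
    ∃ D : List (QUnitary n), D.Sublist L ∧ x = D.prod := by
  induction hx using Subgroup.closure_induction_left with
  | one => exact ⟨[], List.nil_sublist L, rfl⟩
  | mul_left A hA y _ ih =>
    obtain ⟨D, hD, rfl⟩ := ih
    exact exists_mul_prod_eq h.mul_self h.commute hA hD
  | inv_mul_cancel A hA y _ ih =>
    obtain ⟨D, hD, rfl⟩ := ih
    rw [inv_eq_of_mul_eq_one_left (h.mul_self A hA)]
    exact exists_mul_prod_eq h.mul_self h.commute hA hD

end IsStabilizerFamily

/-! ### Replacement of an anti-commuting generator -/

theorem Generator.commute_of_not_antiCommutes {T : Generator n m} {S : PauliObservable n}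
    (hT : IsPauli T.op) (h : ¬ T.AntiCommutes S) : Commute T.op S.op :=
  (hT.commute_or_anticommute S.isPauli).resolve_right h

theorem Generator.op_update (S : PauliObservable n) (T T' : Generator n m) :
    (Generator.update S T T').op = T'.op ∨ (Generator.update S T T').op = T.op * T'.op := by
  unfold Generator.update
  split_ifs <;> simp

theorem Generator.commute_op_update {S : PauliObservable n} {T T' : Generator n m}
    (hT : T.AntiCommutes S) (hT' : IsPauli T'.op) : Commute (Generator.update S T T').op S.op := by
  unfold Generator.update
  split_ifs with h
  · change T.op * T'.op * S.op = S.op * (T.op * T'.op)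
    rw [Generator.AntiCommutes] at hT h
    rw [mul_assoc, h, mul_neg, ← mul_assoc, hT, neg_mul, neg_neg, mul_assoc]
  · exact Generator.commute_of_not_antiCommutes hT' h

theorem IsStabilizerFamily.update {T : Generator n m} {R : List (Generator n m)}
    (h : IsStabilizerFamily ((T :: R).map Generator.op)) (S : PauliObservable n) :
    IsStabilizerFamily ((R.map (Generator.update S T)).map Generator.op) := by
  have hmem : ∀ T' ∈ R, T'.op ∈ (T :: R).map Generator.op := fun T' hT' =>
    List.mem_map_of_mem (List.mem_cons_of_mem _ hT')
  have hTm : T.op ∈ (T :: R).map Generator.op := by simp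
  have hcom : ∀ T' ∈ R, Commute (Generator.update S T T').op T.op := by
    intro T' hT'
    rcases Generator.op_update S T T' with e | e <;> rw [e]
    · exact h.commute _ (hmem T' hT') _ hTm
    · exact (Commute.refl _).mul_left (h.commute _ (hmem T' hT') _ hTm)
  -- Each replaced generator contributes a factor `T`, and pairs of such factors cancel, so what is
  -- left is the product of a nonempty subfamily of `T :: R`.
  have hprod : ∀ D : List (Generator n m), D.Sublist R →
      ((D.map (Generator.update S T)).map Generator.op).prod = (D.map Generator.op).prod ∨
      ((D.map (Generator.update S T)).map Generator.op).prod =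
        T.op * (D.map Generator.op).prod := by
    intro D hD
    induction D with
    | nil => simp
    | cons T' D ih =>
      have hT' := hD.subset (List.mem_cons_self (a := T') (l := D))
      have hc := (h.commute _ (hmem T' hT') _ hTm).eq
      simp only [List.map_cons, List.prod_cons]
      rcases Generator.op_update S T T' with e | e <;>
        rcases ih ((List.sublist_cons_self T' D).trans hD) with i | i <;> rw [e, i]
      · exact Or.inl rfl
      · right; rw [← mul_assoc, hc, mul_assoc]
      · right; rw [mul_assoc]
      · left
        rw [mul_assoc, ← mul_assoc T'.op, hc, ← mul_assoc, ← mul_assoc, h.mul_self _ hTm, one_mul]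
  refine ⟨?_, ?_, ?_, ?_⟩
  · simp only [List.map_map, List.mem_map, Function.comp_apply]
    rintro _ ⟨T', hT', rfl⟩
    rcases Generator.op_update S T T' with e | e <;> rw [e]
    · exact h.isPauli _ (hmem T' hT')
    · exact (h.isPauli _ hTm).mul (h.isPauli _ (hmem T' hT'))
  · simp only [List.map_map, List.mem_map, Function.comp_apply]
    rintro _ ⟨T', hT', rfl⟩
    rcases Generator.op_update S T T' with e | e <;> rw [e]
    · exact h.mul_self _ (hmem T' hT')
    · rw [(h.commute _ (hmem T' hT') _ hTm).mul_mul_mul_comm, h.mul_self _ hTm,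
        h.mul_self _ (hmem T' hT'), one_mul]
  · simp only [List.map_map, List.mem_map, Function.comp_apply]
    rintro _ ⟨T', hT', rfl⟩ _ ⟨T'', hT'', rfl⟩
    rcases Generator.op_update S T T'' with e | e <;> rw [e]
    · rcases Generator.op_update S T T' with e' | e' <;> rw [e']
      · exact h.commute _ (hmem T' hT') _ (hmem T'' hT'')
      · exact (h.commute _ hTm _ (hmem T'' hT'')).mul_left
          (h.commute _ (hmem T' hT') _ (hmem T'' hT''))
    · refine (hcom T' hT').mul_right ?_
      rcases Generator.op_update S T T' with e | e <;> rw [e]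
      · exact h.commute _ (hmem T' hT') _ (hmem T'' hT'')
      · exact (h.commute _ hTm _ (hmem T'' hT'')).mul_left
          (h.commute _ (hmem T' hT') _ (hmem T'' hT''))
  · intro D hD hne
    obtain ⟨D', hD', rfl⟩ := List.sublist_map_iff.mp hD
    obtain ⟨D, hE, rfl⟩ := List.sublist_map_iff.mp hD'
    have hne' : D ≠ [] := by
      rintro rfl
      exact hne rfl
    rcases hprod D hE with e | e <;> rw [e]
    · exact h.trace_prod _ ((hE.cons T).map _) (by simpa using hne')
    · exact h.trace_prod ((T :: D).map Generator.op) ((hE.cons_cons T).map _) (by simp)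

/-- Products of the updated generators commute with `T`, while `S` anti-commutes with it, so
conjugation by `T` shows that their product with `S` has trace zero. -/
theorem IsStabilizerFamily.update_append {T : Generator n m} {R : List (Generator n m)}
    (h : IsStabilizerFamily ((T :: R).map Generator.op)) (S : PauliObservable n)
    (hT : T.AntiCommutes S) :
    IsStabilizerFamily ((R.map (Generator.update S T)).map Generator.op ++ [S.op]) := by
  have hmem : ∀ T' ∈ R, T'.op ∈ (T :: R).map Generator.op := fun T' hT' =>
    List.mem_map_of_mem (List.mem_cons_of_mem _ hT')
  have hTm : T.op ∈ (T :: R).map Generator.op := by simp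
  have hcom : ∀ A ∈ (R.map (Generator.update S T)).map Generator.op, Commute T.op A := by
    simp only [List.map_map, List.mem_map, Function.comp_apply]
    rintro _ ⟨T', hT', rfl⟩
    rcases Generator.op_update S T T' with e | e <;> rw [e]
    · exact h.commute _ hTm _ (hmem T' hT')
    · exact (Commute.refl _).mul_right (h.commute _ hTm _ (hmem T' hT'))
  refine (h.update S).append S ?_ fun D hD => ?_
  · simp only [List.map_map, List.mem_map, Function.comp_apply]
    rintro _ ⟨T', hT', rfl⟩
    exact Generator.commute_op_update hT (h.isPauli _ (hmem T' hT'))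
  · have hTD : Commute T.op D.prod := Commute.list_prod_right _ _ fun B hB => hcom B (hD.subset hB)
    have e1 : T.op * (D.prod * S.op) * T.op = -(D.prod * S.op) := by
      have hST : S.op * T.op = -(T.op * S.op) := by
        rw [Generator.AntiCommutes] at hT
        rw [hT, neg_neg]
      rw [mul_assoc, mul_assoc, hST, mul_neg, mul_neg, ← mul_assoc D.prod, ← hTD.eq,
        mul_assoc T.op D.prod, ← mul_assoc T.op, h.mul_self _ hTm, one_mul]
    have e2 := congrArg (fun A : QUnitary n => (A : QOp n).trace) e1
    simp only [coe_neg_unitary, Matrix.trace_neg] at e2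
    rw [Submonoid.coe_mul, Matrix.trace_mul_comm, ← Submonoid.coe_mul, ← mul_assoc,
      h.mul_self _ hTm, one_mul, Submonoid.coe_mul] at e2
    exact self_eq_neg.mp e2

/-! ### The projector of a stabilizer family -/

/-- The sum `∑_{k ∈ K(T)} o_k` of the outcomes that enter the generator `T`. -/
def Generator.parity (T : Generator n m) (o : Fin m → ZMod 2) : ZMod 2 :=
  ∑ k, T.label k * o k

/-- The operator `1 + (-1)^{∑_{k ∈ K(T)} o_k} T`, twice the projector onto the corresponding
eigenspace of `T`. -/
noncomputable def Generator.factor (o : Fin m → ZMod 2) (T : Generator n m) : QOp n :=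
  1 + outcomeSign (T.parity o) • (T.op : QOp n)

/-- The product of the operators `1 + (-1)^{∑_{k ∈ K(T)} o_k} T` over a list of generators: up to
a power of `2`, the projector onto the stabilized subspace that goes with the outcomes `o`. -/
noncomputable def stabilizedOp (L : List (Generator n m)) (o : Fin m → ZMod 2) : QOp n :=
  (L.map (Generator.factor o)).prod

theorem stabilizedOp_cons (T : Generator n m) (L : List (Generator n m)) (o : Fin m → ZMod 2) :
    stabilizedOp (T :: L) o = T.factor o * stabilizedOp L o := by
  simp [stabilizedOp]

theorem stabilizedOp_append (L L' : List (Generator n m)) (o : Fin m → ZMod 2) :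
    stabilizedOp (L ++ L') o = stabilizedOp L o * stabilizedOp L' o := by
  simp [stabilizedOp]

theorem coe_commute {A B : QUnitary n} (h : Commute A B) : Commute (A : QOp n) (B : QOp n) :=
  congrArg (Subtype.val : QUnitary n → QOp n) h.eq

theorem commute_factor {A : QOp n} {T : Generator n m} (h : Commute A (T.op : QOp n))
    (o : Fin m → ZMod 2) : Commute A (T.factor o) :=
  (Commute.one_right A).add_right (h.smul_right _)

theorem commute_stabilizedOp {A : QOp n} {L : List (Generator n m)}
    (h : ∀ T ∈ L, Commute A (T.op : QOp n)) (o : Fin m → ZMod 2) :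
    Commute A (stabilizedOp L o) := by
  refine Commute.list_prod_right _ _ ?_
  simp only [List.mem_map]
  rintro _ ⟨T, hT, rfl⟩
  exact commute_factor (h T hT) o

theorem stabilizedOp_perm {L L' : List (Generator n m)} (p : L.Perm L')
    (h : ∀ T ∈ L, ∀ T' ∈ L, Commute T.op T'.op) (o : Fin m → ZMod 2) :
    stabilizedOp L o = stabilizedOp L' o := by
  refine (p.map _).prod_eq' (List.pairwise_of_forall_mem_list ?_)
  simp only [List.mem_map]
  rintro _ ⟨T, hT, rfl⟩ _ ⟨T', hT', rfl⟩
  exact commute_factor (commute_factor (coe_commute (h T' hT' T hT)) o).symm o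

theorem Generator.coe_op_mul_self {T : Generator n m} (h : T.op * T.op = 1) :
    (T.op : QOp n) * (T.op : QOp n) = 1 :=
  congrArg (Subtype.val : QUnitary n → QOp n) h

theorem Generator.op_mul_factor {T : Generator n m} (h : T.op * T.op = 1) (o : Fin m → ZMod 2) :
    (T.op : QOp n) * T.factor o = outcomeSign (T.parity o) • T.factor o := by
  rw [Generator.factor, mul_add, mul_one, Matrix.mul_smul, T.coe_op_mul_self h, smul_add,
    smul_smul, outcomeSign_mul_self, one_smul, add_comm]

theorem op_mul_stabilizedOp {L : List (Generator n m)}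
    (h : IsStabilizerFamily (L.map Generator.op)) {T : Generator n m} (hT : T ∈ L)
    (o : Fin m → ZMod 2) :
    (T.op : QOp n) * stabilizedOp L o = outcomeSign (T.parity o) • stabilizedOp L o := by
  obtain ⟨L₁, L₂, rfl⟩ := List.append_of_mem hT
  have hc : ∀ T' ∈ L₁, Commute (T.op : QOp n) T'.op := fun T' hT' =>
    coe_commute (h.commute _ (by simp) _ (List.mem_map_of_mem (by simp [hT'])))
  rw [stabilizedOp_append, stabilizedOp_cons, ← mul_assoc, (commute_stabilizedOp hc o).eq,
    mul_assoc, ← mul_assoc (T.op : QOp n),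
    Generator.op_mul_factor (h.mul_self _ (by simp)), Matrix.smul_mul, Matrix.mul_smul]

/-- The sign by which a product of generators acts is read off from the sum of their labels. -/
theorem prod_mul_stabilizedOp {L : List (Generator n m)}
    (h : IsStabilizerFamily (L.map Generator.op)) {D : List (Generator n m)} (hD : D.Sublist L)
    (o : Fin m → ZMod 2) :
    ((D.map Generator.op).prod : QOp n) * stabilizedOp L o =
      outcomeSign (∑ k, (D.map Generator.label).sum k * o k) • stabilizedOp L o := by
  induction D with
  | nil => simp
  | cons T D ih =>
    have hsum : ∑ k, ((T :: D).map Generator.label).sum k * o k =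
        T.parity o + ∑ k, (D.map Generator.label).sum k * o k := by
      simp [Generator.parity, add_mul, Finset.sum_add_distrib]
    rw [List.map_cons, List.prod_cons, Submonoid.coe_mul, mul_assoc,
      ih ((List.sublist_cons_self T D).trans hD), Matrix.mul_smul,
      op_mul_stabilizedOp h (hD.subset (by simp)), smul_smul, hsum, outcomeSign_add, mul_comm]

/-- Expanding the product gives a combination of the operators `B ∏ D` over all subfamilies. -/
theorem trace_mul_stabilizedOp_eq_zero (L : List (Generator n m)) (o : Fin m → ZMod 2) (B : QOp n)
    (hB : ∀ D : List (Generator n m), D.Sublist L →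
      (B * ((D.map Generator.op).prod : QUnitary n)).trace = 0) :
    (B * stabilizedOp L o).trace = 0 := by
  induction L generalizing B with
  | nil => simpa [stabilizedOp] using hB [] (List.Sublist.refl _)
  | cons T L ih =>
    have h1 := ih B fun D hD => hB D (hD.cons T)
    have h2 := ih (B * T.op) fun D hD => by
      have := hB (T :: D) (hD.cons_cons T)
      rwa [List.map_cons, List.prod_cons, Submonoid.coe_mul, ← mul_assoc] at this
    rw [stabilizedOp_cons, Generator.factor, add_mul, one_mul, mul_add, Matrix.trace_add, h1,
      Matrix.smul_mul, Matrix.mul_smul, Matrix.trace_smul, ← mul_assoc, h2, smul_zero, add_zero]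

/-- Expanding the product, only the empty subfamily contributes to the trace. -/
theorem trace_stabilizedOp {L : List (Generator n m)}
    (h : ∀ D : List (Generator n m), D.Sublist L → D ≠ [] →
      ((D.map Generator.op).prod : QOp n).trace = 0) (o : Fin m → ZMod 2) :
    (stabilizedOp L o).trace = (1 : QOp n).trace := by
  induction L with
  | nil => simp [stabilizedOp]
  | cons T L ih =>
    have h2 := trace_mul_stabilizedOp_eq_zero L o (T.op : QOp n) fun D hD => by
      have := h (T :: D) (hD.cons_cons T) (by simp)
      rwa [List.map_cons, List.prod_cons, Submonoid.coe_mul] at this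
    rw [stabilizedOp_cons, Generator.factor, add_mul, one_mul, Matrix.trace_add,
      ih fun D hD => h D (hD.cons T), Matrix.smul_mul, Matrix.trace_smul, h2, smul_zero, add_zero]

theorem stabilizedOp_ne_zero {L : List (Generator n m)}
    (h : IsStabilizerFamily (L.map Generator.op)) (o : Fin m → ZMod 2) : stabilizedOp L o ≠ 0 := by
  intro h0
  have := trace_stabilizedOp (L := L) (fun D hD hne => h.trace_prod _ (hD.map _) (by simpa)) o
  rw [h0, Matrix.trace_zero, Matrix.trace_one] at this
  have h2 : (0 : ℂ) = 2 ^ n := by simpa using this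
  exact pow_ne_zero n two_ne_zero h2.symm

theorem parity_extend (T : Generator n m) (o : Fin (m + 1) → ZMod 2) :
    T.extend.parity o = T.parity fun k => o k.castSucc := by
  simp [Generator.parity, Generator.extend, Fin.sum_univ_castSucc]

theorem stabilizedOp_extend (L : List (Generator n m)) (o : Fin (m + 1) → ZMod 2) :
    stabilizedOp (L.map Generator.extend) o = stabilizedOp L fun k => o k.castSucc := by
  simp only [stabilizedOp, List.map_map]
  congr 2
  ext1 T
  rw [Function.comp_apply, Generator.factor, Generator.factor, parity_extend, Generator.extend]

theorem stabilizedOp_ofMeasurement (S : PauliObservable n) (o : Fin (m + 1) → ZMod 2) :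
    stabilizedOp [Generator.ofMeasurement m S] o =
      1 + outcomeSign (o (Fin.last m)) • (S.op : QOp n) := by
  simp [stabilizedOp, Generator.factor, Generator.parity, Generator.ofMeasurement, Pi.single_apply]

theorem stabilizedOp_conj (U : CliffordGate n) (L : List (Generator n m)) (o : Fin m → ZMod 2) :
    stabilizedOp (L.map (Generator.conj U)) o =
      (U.op : QOp n) * stabilizedOp L o * (U.op : QOp n)ᴴ := by
  have hU : (U.op : QOp n) * (U.op : QOp n)ᴴ = 1 := Matrix.mem_unitaryGroup_iff.mp U.op.2
  have hU' : (U.op : QOp n)ᴴ * (U.op : QOp n) = 1 := Matrix.mem_unitaryGroup_iff'.mp U.op.2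
  induction L with
  | nil => simp [stabilizedOp, hU]
  | cons T L ih =>
    have hT : (T.conj U).factor o = (U.op : QOp n) * T.factor o * (U.op : QOp n)ᴴ := by
      change 1 + outcomeSign (T.parity o) •
        ((U.op : QOp n) * (T.op : QOp n) * (U.op : QOp n)ᴴ) = _
      rw [Generator.factor, mul_add, add_mul, mul_one, hU, Matrix.mul_smul, Matrix.smul_mul]
    rw [List.map_cons, stabilizedOp_cons, stabilizedOp_cons, ih, hT]
    simp only [mul_assoc]
    rw [← mul_assoc (U.op : QOp n)ᴴ, hU', one_mul]

/-- On the eigenspace of `T` selected by the outcomes, the product `T T'` acts as `± T'`, and the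
sign is accounted for by the symmetric difference of the labels. -/
theorem factor_mul_factor_update {T : Generator n m} (h : T.op * T.op = 1) (S : PauliObservable n)
    (T' : Generator n m) (o : Fin m → ZMod 2) :
    T.factor o * (Generator.update S T T').factor o = T.factor o * T'.factor o := by
  unfold Generator.update
  split_ifs with hT'
  · have hp : Generator.parity ⟨T.op * T'.op, T.label + T'.label⟩ o = T.parity o + T'.parity o := by
      simp [Generator.parity, add_mul, Finset.sum_add_distrib]
    have hf : T.factor o * (T.op : QOp n) = outcomeSign (T.parity o) • T.factor o := by
      rw [← (commute_factor (Commute.refl (T.op : QOp n)) o).eq, Generator.op_mul_factor h]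
    rw [Generator.factor.eq_def o ⟨T.op * T'.op, T.label + T'.label⟩, hp, Generator.factor.eq_def o T',
      mul_add, mul_add, Submonoid.coe_mul, Matrix.mul_smul, ← mul_assoc, hf, Matrix.smul_mul,
      smul_smul, outcomeSign_add, mul_right_comm, outcomeSign_mul_self, one_mul, Matrix.mul_smul]
  · rfl

theorem stabilizedOp_update {T : Generator n m} {R : List (Generator n m)}
    (h : IsStabilizerFamily ((T :: R).map Generator.op)) (S : PauliObservable n)
    (o : Fin m → ZMod 2) :
    T.factor o * stabilizedOp (R.map (Generator.update S T)) o = stabilizedOp (T :: R) o := by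
  rw [stabilizedOp_cons]
  have hsub : ∀ T' ∈ R, Commute (T.factor o) (T'.factor o) := fun T' hT' =>
    commute_factor (commute_factor (coe_commute (h.commute _
      (List.mem_map_of_mem (List.mem_cons_of_mem _ hT')) _ (by simp))) o).symm o
  have hsq : T.op * T.op = 1 := h.mul_self _ (by simp)
  clear h
  induction R with
  | nil => rfl
  | cons T' R ih =>
    have hc := (hsub T' (by simp)).eq
    rw [List.map_cons, stabilizedOp_cons, stabilizedOp_cons, ← mul_assoc,
      factor_mul_factor_update hsq, hc, mul_assoc, ih fun T hT => hsub T (by simp [hT]),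
      ← mul_assoc, ← hc, mul_assoc]

/-! ### Effect of a measurement on stabilized operators -/

theorem PauliObservable.coe_op_mul_self (S : PauliObservable n) :
    (S.op : QOp n) * (S.op : QOp n) = 1 :=
  congrArg (Subtype.val : QUnitary n → QOp n) S.op_mul_self

theorem PauliObservable.projector_eq (S : PauliObservable n) (b : ZMod 2) :
    S.projector b = (1 / 2 : ℂ) • (1 + outcomeSign b • (S.op : QOp n)) := rfl

theorem PauliObservable.projector_mul_self (S : PauliObservable n) (b : ZMod 2) :
    S.projector b * S.projector b = S.projector b := by
  have h : (1 + outcomeSign b • (S.op : QOp n)) * (1 + outcomeSign b • (S.op : QOp n)) =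
      (2 : ℂ) • (1 + outcomeSign b • (S.op : QOp n)) := by
    simp only [mul_add, add_mul, Matrix.smul_mul, Matrix.mul_smul, S.coe_op_mul_self, smul_smul,
      outcomeSign_mul_self, mul_one, one_mul, one_smul, two_smul]
    abel
  rw [S.projector_eq, Matrix.smul_mul, Matrix.mul_smul, h, smul_smul, smul_smul]
  norm_num

theorem PauliObservable.commute_projector {A : QOp n} {S : PauliObservable n}
    (h : Commute A (S.op : QOp n)) (b : ZMod 2) : Commute A (S.projector b) :=
  ((Commute.one_right A).add_right (h.smul_right _)).smul_right _

theorem PauliObservable.projector_isHermitian (S : PauliObservable n) (b : ZMod 2) :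
    (S.projector b)ᴴ = S.projector b := by
  rcases zmod_two_cases b with rfl | rfl <;>
    simp [S.projector_eq, Matrix.conjTranspose_smul, S.isHermitian.eq]

theorem PauliObservable.projector_zero_add_projector_one (S : PauliObservable n) :
    S.projector 0 + S.projector 1 = 1 := by
  rw [S.projector_eq, S.projector_eq, outcomeSign_zero, outcomeSign_one, ← smul_add]
  ext i j
  simp
  ring

/-- An operator that anti-commutes with `S` maps each eigenspace of `S` to the other one. -/
theorem Generator.AntiCommutes.projector_mul_mul_projector {T : Generator n m}
    {S : PauliObservable n} (h : T.AntiCommutes S) (b : ZMod 2) :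
    S.projector b * (T.op : QOp n) * S.projector b = 0 := by
  have h' : (T.op : QOp n) * (S.op : QOp n) = -((S.op : QOp n) * (T.op : QOp n)) :=
    congrArg (Subtype.val : QUnitary n → QOp n) h
  have key : (1 + outcomeSign b • (S.op : QOp n)) * (T.op : QOp n) *
      (1 + outcomeSign b • (S.op : QOp n)) = 0 := by
    have h2 : (S.op : QOp n) * (T.op : QOp n) * (S.op : QOp n) = -(T.op : QOp n) := by
      rw [mul_assoc, h', mul_neg, ← mul_assoc, S.coe_op_mul_self, one_mul]
    simp only [mul_add, add_mul, Matrix.smul_mul, Matrix.mul_smul, smul_smul, mul_one, one_mul, h',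
      h2, outcomeSign_mul_self, one_smul, smul_neg]
    abel
  rw [S.projector_eq, Matrix.smul_mul, Matrix.smul_mul, Matrix.mul_smul, key, smul_zero, smul_zero]

/-! ### Possible outcomes and Kraus operators -/

/-- The operator `K` for which the branch with outcomes `o` maps `ρ` to `K ρ K†`. -/
noncomputable def CliffordCircuit.kraus :
    {m : ℕ} → CliffordCircuit n m → (Fin m → ZMod 2) → QOp n
  | _, .nil, _ => 1
  | _, .gate C U, o => (U.op : QOp n) * C.kraus o
  | _, .measure (m := m) C S, o =>
      S.projector (o (Fin.last m)) * C.kraus fun k => o k.castSucc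

theorem CliffordCircuit.branch_eq (C : CliffordCircuit n m) (o : Fin m → ZMod 2) (ρ : QOp n) :
    C.branch o ρ = C.kraus o * ρ * (C.kraus o)ᴴ := by
  induction C with
  | nil => simp [CliffordCircuit.branch, CliffordCircuit.kraus]
  | gate C U ih =>
    simp only [CliffordCircuit.branch, CliffordCircuit.kraus, ih, Matrix.conjTranspose_mul,
      mul_assoc]
  | measure C S ih =>
    simp only [CliffordCircuit.branch, CliffordCircuit.kraus, ih, Matrix.conjTranspose_mul,
      S.projector_isHermitian, mul_assoc]

theorem CliffordCircuit.branch_one_eq_zero_iff (C : CliffordCircuit n m) (o : Fin m → ZMod 2) :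
    C.branch o 1 = 0 ↔ C.kraus o = 0 := by
  rw [C.branch_eq, mul_one, Matrix.self_mul_conjTranspose_eq_zero]

/-- Outcomes that can occur at all already occur on the maximally mixed state. -/
theorem CliffordCircuit.mem_outcomeCode_iff (C : CliffordCircuit n m) (o : Fin m → ZMod 2) :
    o ∈ C.outcomeCode ↔ C.branch o 1 ≠ 0 := by
  rw [Ne, C.branch_one_eq_zero_iff]
  constructor
  · rintro ⟨ρ, -, hρ⟩ h0
    rw [CliffordCircuit.prob, C.branch_eq, h0] at hρ
    simp at hρ
  · intro hK
    have hd : (0 : ℝ) < (2 ^ n)⁻¹ := by positivity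
    refine ⟨((2 ^ n)⁻¹ : ℝ) • 1, ⟨Matrix.PosSemidef.one.smul hd.le, ?_⟩, ?_⟩
    · rw [Matrix.trace_smul, Matrix.trace_one]
      simp
    · have h0 : 0 ≤ (C.kraus o * (C.kraus o)ᴴ).trace :=
        (Matrix.posSemidef_self_mul_conjTranspose _).trace_nonneg
      have hne : (C.kraus o * (C.kraus o)ᴴ).trace ≠ 0 :=
        fun h => hK (Matrix.trace_mul_conjTranspose_self_eq_zero_iff.mp h)
      have hpos := (Complex.pos_iff.mp (lt_of_le_of_ne h0 hne.symm)).1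
      rw [CliffordCircuit.prob, C.branch_eq, Matrix.mul_smul, mul_one, Matrix.smul_mul,
        Matrix.trace_smul, Complex.smul_re]
      exact mul_pos hd hpos

/-- The two projectors of a measurement add up to `1`, so at least one outcome extends a possible
outcome string. -/
theorem CliffordCircuit.outcomeCode_nonempty (C : CliffordCircuit n m) : C.outcomeCode.Nonempty := by
  suffices h : ∃ o, C.kraus o ≠ 0 by
    obtain ⟨o, ho⟩ := h
    exact ⟨o, (C.mem_outcomeCode_iff o).mpr fun h => ho ((C.branch_one_eq_zero_iff o).mp h)⟩
  induction C with
  | nil => exact ⟨0, one_ne_zero⟩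
  | gate C U ih =>
    obtain ⟨o, ho⟩ := ih
    refine ⟨o, fun h => ho ?_⟩
    have hU : (U.op : QOp n)ᴴ * (U.op : QOp n) = 1 := Matrix.mem_unitaryGroup_iff'.mp U.op.2
    rw [CliffordCircuit.kraus] at h
    rw [← one_mul (C.kraus o), ← hU, mul_assoc, h, mul_zero]
  | measure C S ih =>
    obtain ⟨o, ho⟩ := ih
    by_contra! hall
    have hb : ∀ b, S.projector b * C.kraus o = 0 := fun b => by
      simpa [CliffordCircuit.kraus] using hall (Fin.snoc (α := fun _ => ZMod 2) o b)
    apply ho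
    rw [← one_mul (C.kraus o), ← S.projector_zero_add_projector_one, add_mul, hb, hb, add_zero]

/-! ### The loop invariant of the simulation -/

theorem AffineCheck.holds_extend (c : AffineCheck m) (o : Fin (m + 1) → ZMod 2) :
    c.extend.Holds o ↔ c.Holds fun k => o k.castSucc := by
  simp [AffineCheck.Holds, AffineCheck.extend, Fin.sum_univ_castSucc]

/-- The loop invariant: the generators form a stabilizer family, and the circuit maps the identity
to a nonzero multiple of the operator stabilized by them if the outcomes satisfy the checks, and to
zero otherwise. -/
structure SimState.Tracks (A : SimState n m) (C : CliffordCircuit n m) : Prop where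
  family : IsStabilizerFamily (A.gens.map Generator.op)
  branch_of_holds : ∀ o, (∀ c ∈ A.checks, c.Holds o) →
    ∃ z : ℂ, z ≠ 0 ∧ C.branch o 1 = z • stabilizedOp A.gens o
  branch_of_not_holds : ∀ o, (¬ ∀ c ∈ A.checks, c.Holds o) → C.branch o 1 = 0

theorem Generator.map_op_extend (L : List (Generator n m)) :
    (L.map Generator.extend).map Generator.op = L.map Generator.op := by
  rw [List.map_map]; rfl

theorem SimState.prod_mem_stabilizerGroup (A : SimState n m) {D : List (QUnitary n)}
    (hD : D.Sublist (A.gens.map Generator.op)) : D.prod ∈ A.stabilizerGroup :=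
  list_prod_mem fun _ hP => Subgroup.subset_closure (List.mem_map.mp (hD.subset hP))

namespace SimState.Tracks

variable {A : SimState n m} {C : CliffordCircuit n m}

theorem outcomeCode_eq (h : A.Tracks C) : C.outcomeCode = {o | ∀ c ∈ A.checks, c.Holds o} := by
  ext o
  rw [C.mem_outcomeCode_iff, Set.mem_ofPred_eq]
  constructor
  · exact not_imp_comm.mp (h.branch_of_not_holds o)
  · intro ho
    obtain ⟨z, hz, hb⟩ := h.branch_of_holds o ho
    rw [hb]
    exact smul_ne_zero hz (stabilizedOp_ne_zero h.family o)

theorem start : SimState.Tracks { gens := [], checks := [] } (.nil : CliffordCircuit n 0) where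
  family := .nil
  branch_of_holds _ _ := ⟨1, one_ne_zero, by simp [CliffordCircuit.branch, stabilizedOp]⟩
  branch_of_not_holds _ h := absurd (by simp) h

theorem gate (h : A.Tracks C) (U : CliffordGate n) :
    SimState.Tracks { gens := A.gens.map (Generator.conj U), checks := A.checks } (C.gate U) where
  family := by
    have := h.family.conj U
    rw [List.map_map] at this ⊢
    exact this
  branch_of_holds o ho := by
    obtain ⟨z, hz, hb⟩ := h.branch_of_holds o ho
    refine ⟨z, hz, ?_⟩
    rw [CliffordCircuit.branch, hb, stabilizedOp_conj, Matrix.mul_smul, Matrix.smul_mul]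
  branch_of_not_holds o ho := by
    rw [CliffordCircuit.branch, h.branch_of_not_holds o ho, mul_zero, zero_mul]

/-- A measurement that yields no new check: it suffices that projecting the old stabilized operator
gives a fixed nonzero multiple of the new one, whatever the outcome. -/
theorem measure_of_checks_extend (h : A.Tracks C) {S : PauliObservable n}
    {L : List (Generator n (m + 1))} (hL : IsStabilizerFamily (L.map Generator.op)) {z : ℂ}
    (hz : z ≠ 0) (hb : ∀ o : Fin (m + 1) → ZMod 2,
      S.projector (o (Fin.last m)) * stabilizedOp A.gens (fun k => o k.castSucc) *
        S.projector (o (Fin.last m)) = z • stabilizedOp L o) :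
    SimState.Tracks { gens := L, checks := A.checks.map AffineCheck.extend } (C.measure S) where
  family := hL
  branch_of_holds o ho := by
    simp only [List.forall_mem_map, AffineCheck.holds_extend] at ho
    obtain ⟨w, hw, h'⟩ := h.branch_of_holds _ ho
    refine ⟨w * z, mul_ne_zero hw hz, ?_⟩
    rw [CliffordCircuit.branch, h', Matrix.mul_smul, Matrix.smul_mul, hb, smul_smul]
  branch_of_not_holds o ho := by
    simp only [List.forall_mem_map, AffineCheck.holds_extend] at ho
    rw [CliffordCircuit.branch, h.branch_of_not_holds _ ho, mul_zero, zero_mul]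

theorem exists_sublist_of_mem (h : A.Tracks C) {x : QUnitary n} (hx : x ∈ A.stabilizerGroup) :
    ∃ D : List (Generator n m), D.Sublist A.gens ∧ x = (D.map Generator.op).prod := by
  have hx' : x ∈ Subgroup.closure {P | P ∈ A.gens.map Generator.op} := by
    simpa only [SimState.stabilizerGroup, List.mem_map] using hx
  obtain ⟨D, hD, rfl⟩ := h.family.exists_prod_of_mem_closure hx'
  obtain ⟨D', hD', rfl⟩ := List.sublist_map_iff.mp hD
  exact ⟨D', hD', rfl⟩

/-- A measurement whose outcome is determined: `S` acts on the stabilized operator as the sign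
predicted by the decomposition of `±S`, so one outcome survives and the other is annihilated. -/
theorem measure_redundant (h : A.Tracks C) {S : PauliObservable n} {b : ZMod 2}
    {D : List (Generator n m)} (hD : D.Sublist A.gens)
    (hprod : S.signed b = (D.map Generator.op).prod) :
    SimState.Tracks
      { gens := A.gens.map Generator.extend
        checks := A.checks.map AffineCheck.extend ++
          [{ coeff := Fin.snoc (α := fun _ => ZMod 2) (D.map Generator.label).sum 1, rhs := b }] }
      (C.measure S) := by
  set K := (D.map Generator.label).sum with hK
  have hS : ∀ o, (S.op : QOp n) * stabilizedOp A.gens o =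
      outcomeSign (b + ∑ k, K k * o k) • stabilizedOp A.gens o := by
    intro o
    have h1 := prod_mul_stabilizedOp h.family hD o
    rw [← hprod, S.coe_signed, Matrix.smul_mul] at h1
    rw [outcomeSign_add, mul_smul, hK, ← h1, smul_smul, outcomeSign_mul_self, one_smul]
  have hP : ∀ o a, S.projector a * stabilizedOp A.gens o =
      if (∑ k, K k * o k) + a = b then stabilizedOp A.gens o else 0 := by
    intro o a
    rw [S.projector_eq, Matrix.smul_mul, add_mul, one_mul, Matrix.smul_mul, hS, smul_smul,
      ← outcomeSign_add]
    generalize (∑ k, K k * o k) = s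
    split_ifs with e
    · rw [← e, show a + (s + a + s) = 0 by grind, outcomeSign_zero, one_smul, ← two_smul ℂ,
        smul_smul]
      norm_num
    · have aux : ∀ a b s : ZMod 2, ¬ s + a = b → a + (b + s) = 1 := by decide
      rw [aux a b s e, outcomeSign_one]
      simp
  have hcheck : ∀ o : Fin (m + 1) → ZMod 2,
      AffineCheck.Holds { coeff := Fin.snoc (α := fun _ => ZMod 2) K 1, rhs := b } o ↔
        (∑ k, K k * o k.castSucc) + o (Fin.last m) = b := by
    intro o
    simp [AffineCheck.Holds, Fin.sum_univ_castSucc]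
  refine ⟨by simpa only [Generator.map_op_extend] using h.family, fun o ho => ?_, fun o ho => ?_⟩
  · simp only [List.forall_mem_append, List.forall_mem_map, AffineCheck.holds_extend,
      List.forall_mem_singleton, hcheck] at ho
    obtain ⟨z, hz, hb⟩ := h.branch_of_holds _ ho.1
    refine ⟨z, hz, ?_⟩
    have hcomm : Commute (stabilizedOp A.gens fun k => o k.castSucc) (S.op : QOp n) := by
      have hc : Commute ((S.signed b : QUnitary n) : QOp n)
          (stabilizedOp A.gens fun k => o k.castSucc) := by
        rw [hprod]
        exact commute_stabilizedOp (fun T hT => coe_commute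
          (h.family.commute_prod (hD.map _) (List.mem_map_of_mem hT)).symm) _
      rw [S.coe_signed] at hc
      have := (hc.smul_left (outcomeSign b)).symm
      rwa [smul_smul, outcomeSign_mul_self, one_smul] at this
    rw [CliffordCircuit.branch, hb, Matrix.mul_smul, Matrix.smul_mul, mul_assoc,
      (PauliObservable.commute_projector hcomm _).eq, ← mul_assoc, S.projector_mul_self, hP,
      if_pos ho.2, stabilizedOp_extend]
  · simp only [List.forall_mem_append, List.forall_mem_map, AffineCheck.holds_extend,
      List.forall_mem_singleton, hcheck] at ho
    rw [CliffordCircuit.branch]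
    by_cases h1 : ∀ c ∈ A.checks, c.Holds fun k => o k.castSucc
    · obtain ⟨z, -, hb⟩ := h.branch_of_holds _ h1
      rw [hb, Matrix.mul_smul, hP, if_neg fun h2 => ho ⟨h1, h2⟩, smul_zero, zero_mul]
    · rw [h.branch_of_not_holds _ h1, mul_zero, zero_mul]

theorem measure_commuting (h : A.Tracks C) {S : PauliObservable n}
    (hmem : ∀ b, S.signed b ∉ A.stabilizerGroup)
    (hcomm : ∀ T ∈ A.gens, ¬ T.AntiCommutes S) :
    SimState.Tracks
      { gens := A.gens.map Generator.extend ++ [Generator.ofMeasurement m S]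
        checks := A.checks.map AffineCheck.extend } (C.measure S) := by
  have hc : ∀ T ∈ A.gens, Commute T.op S.op := fun T hT =>
    Generator.commute_of_not_antiCommutes (h.family.isPauli _ (List.mem_map_of_mem hT)) (hcomm T hT)
  refine h.measure_of_checks_extend (z := 1 / 2) ?_ (by norm_num) fun o => ?_
  · rw [List.map_append, Generator.map_op_extend]
    refine h.family.append_of_commute S (List.forall_mem_map.mpr hc) fun b D hD e => hmem b ?_
    rw [e]
    exact A.prod_mem_stabilizerGroup hD
  · have hS : Commute (stabilizedOp A.gens fun k => o k.castSucc) (S.op : QOp n) :=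
      (commute_stabilizedOp (fun T hT => coe_commute (hc T hT).symm) _).symm
    rw [← (PauliObservable.commute_projector hS _).eq, mul_assoc, S.projector_mul_self,
      stabilizedOp_append, stabilizedOp_extend, stabilizedOp_ofMeasurement, S.projector_eq,
      Matrix.mul_smul]

/-- A measurement with a uniformly random outcome: conjugation by the projector of `S` keeps the
updated generators, which commute with `S`, and erases the generator that anti-commutes with it. -/
theorem measure_antiCommuting (h : A.Tracks C) {S : PauliObservable n}
    {L₁ L₂ : List (Generator n m)} {T : Generator n m} (hT : A.gens = L₁ ++ T :: L₂)
    (hanti : T.AntiCommutes S) :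
    SimState.Tracks
      { gens := ((L₁ ++ L₂).map (Generator.update S T)).map Generator.extend ++
          [Generator.ofMeasurement m S]
        checks := A.checks.map AffineCheck.extend } (C.measure S) := by
  have hp : A.gens.Perm (T :: (L₁ ++ L₂)) := hT ▸ List.perm_middle
  have hf := h.family.perm (hp.map Generator.op)
  refine h.measure_of_checks_extend (z := 1 / 2) ?_ (by norm_num) fun o => ?_
  · rw [List.map_append, Generator.map_op_extend]
    exact hf.update_append S hanti
  · rw [stabilizedOp_perm hp fun T hT T' hT' => h.family.commute _ (List.mem_map_of_mem hT) _
      (List.mem_map_of_mem hT'), ← stabilizedOp_update hf S]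
    have hS : Commute (stabilizedOp ((L₁ ++ L₂).map (Generator.update S T))
        fun k => o k.castSucc) (S.op : QOp n) := by
      refine (commute_stabilizedOp (List.forall_mem_map.mpr fun T' hT' => ?_) _).symm
      exact coe_commute (Generator.commute_op_update hanti
        (hf.isPauli _ (List.mem_map_of_mem (List.mem_cons_of_mem _ hT')))).symm
    have hPS := (PauliObservable.commute_projector hS (o (Fin.last m))).eq
    -- `Π (1 ± T) U Π = (Π ± Π T Π) U = Π U`, where `U` comes from the updated generators.
    rw [mul_assoc, mul_assoc, hPS, ← mul_assoc, ← mul_assoc, Generator.factor, mul_add, add_mul,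
      mul_one, S.projector_mul_self, Matrix.mul_smul, Matrix.smul_mul,
      hanti.projector_mul_mul_projector, smul_zero, add_zero, ← hPS, stabilizedOp_append,
      stabilizedOp_extend, stabilizedOp_ofMeasurement, S.projector_eq, Matrix.mul_smul]

theorem measure (h : A.Tracks C) {S : PauliObservable n} {A' : SimState n (m + 1)}
    (hstep : MeasureStep S A A') : A'.Tracks (C.measure S) := by
  cases hstep with
  | redundant b _ D hD hprod => exact h.measure_redundant hD hprod
  | antiCommuting _ L₁ L₂ T hT hanti => exact h.measure_antiCommuting hT hanti
  | commuting hmem hcomm => exact h.measure_commuting hmem hcomm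

theorem exists_measureStep (h : A.Tracks C) (S : PauliObservable n) :
    ∃ A' : SimState n (m + 1), MeasureStep S A A' := by
  by_cases hmem : ∃ b, S.signed b ∈ A.stabilizerGroup
  · obtain ⟨b, hb⟩ := hmem
    obtain ⟨D, hD, hprod⟩ := h.exists_sublist_of_mem hb
    exact ⟨_, .redundant A b hb D hD hprod⟩
  · push Not at hmem
    by_cases hanti : ∃ T ∈ A.gens, T.AntiCommutes S
    · obtain ⟨T, hT, hTS⟩ := hanti
      obtain ⟨L₁, L₂, hL⟩ := List.append_of_mem hT
      exact ⟨_, .antiCommuting A hmem L₁ L₂ T hL hTS⟩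
    · push Not at hanti
      exact ⟨_, .commuting A hmem hanti⟩

end SimState.Tracks

theorem Simulates.tracks {C : CliffordCircuit n m} {A : SimState n m} (h : Simulates C A) :
    A.Tracks C := by
  induction h with
  | start => exact .start
  | gate C U A _ ih => exact ih.gate U
  | measure C S A A' _ hstep ih => exact ih.measure hstep

theorem exists_simulates (C : CliffordCircuit n m) : ∃ A : SimState n m, Simulates C A := by
  induction C with
  | nil => exact ⟨_, .start⟩
  | gate C U ih =>
    obtain ⟨A, hA⟩ := ih
    exact ⟨_, .gate C U A hA⟩
  | measure C S ih =>
    obtain ⟨A, hA⟩ := ih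
    obtain ⟨A', hA'⟩ := hA.tracks.exists_measureStep S
    exact ⟨A', .measure C S A A' hA hA'⟩

/-- The set of solutions of a list of affine checks, as an affine subspace. -/
def AffineCheck.solutions (R : List (AffineCheck m)) :
    AffineSubspace (ZMod 2) (Fin m → ZMod 2) where
  carrier := {o | ∀ c ∈ R, c.Holds o}
  smul_vsub_vadd_mem' a p q r hp hq hr c hc := by
    have h1 := hp c hc
    have h2 := hq c hc
    have h3 := hr c hc
    simp only [AffineCheck.Holds] at h1 h2 h3 ⊢
    simp only [vsub_eq_sub, vadd_eq_add, Pi.add_apply, Pi.smul_apply, Pi.sub_apply, smul_eq_mul,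
      mul_add, mul_sub, mul_left_comm _ a, Finset.sum_add_distrib, Finset.sum_sub_distrib,
      ← Finset.mul_sum, h1, h2, h3, sub_self, zero_add]

end CliffordSim

/-- The outcome code of a Clifford circuit is a (non-empty) affine subspace, the modified stabilizer
simulation always runs to completion (some run exists, and no partial run gets stuck at a further
measurement), and whatever choices it makes, its output is a complete set of affine checks. -/
theorem mainTheorem1 (n m : ℕ) (C : CliffordCircuit n m) :
    (∃ V : AffineSubspace (ZMod 2) (Fin m → ZMod 2),
      (V : Set (Fin m → ZMod 2)).Nonempty ∧ (V : Set (Fin m → ZMod 2)) = C.outcomeCode) ∧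
    (∃ A : SimState n m, Simulates C A) ∧
    (∀ A : SimState n m, Simulates C A → ∀ S : PauliObservable n,
      ∃ A' : SimState n (m + 1), MeasureStep S A A') ∧
    (∀ A : SimState n m, Simulates C A →
      C.outcomeCode = {o | ∀ c ∈ A.checks, c.Holds o}) := by
  obtain ⟨A, hA⟩ := exists_simulates C
  refine ⟨⟨AffineCheck.solutions A.checks, ?_, hA.tracks.outcomeCode_eq.symm⟩, ⟨A, hA⟩,
    fun A hA S => hA.tracks.exists_measureStep S, fun A hA => hA.tracks.outcomeCode_eq⟩
  have hne := C.outcomeCode_nonempty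
  rwa [hA.tracks.outcomeCode_eq] at hne
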